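/- Let $G$ be a finite group and $p$ a prime. Conventions. A chief factor of $G$ is a quotient $K/H$ with $H<K$ normal subgroups of $G$ such that no normal subgroup of $G$ lies strictly between $H$ and $K$. $G$ is $p$-solvable if every chief factor of $G$ is a $p$-group or a $p'$-group (a group of order prime to $p$), and $p$-supersolvable if every chief factor of $G$ has order $p$ or is a $p'$-group; $\mathscr U_p$ is the class of $p$-supersolvable groups, and $\mathscr U$ the class of supersolvable groups. For $\mathscr F\in\{\mathscr U_p,\mathscr U\}$, the residual $T^{\mathscr F}$ of a group $T$ is the intersection of all normal subgroups $N$ of $T$ with $T/N\in\mathscr F$, and $N_{\mathscr F}(G)=\bigcap_{T\le G}N_G(T^{\mathscr F})$. Put $N^0_{\mathscr F}(G)=1$ and $N^{i+1}_{\mathscr F}(G)/N^i_{\mathscr F}(G)=N_{\mathscr F}(G/N^i_{\mathscr F}(G))$, and let $N^\infty_{\mathscr F}(G)$ be the terminal term of this ascending series. A group is $p$-nilpotent if it has a normal $p'$-subgroup of $p$-power index; $F_p(G)$ is the largest normal $p$-nilpotent subgroup of $G$. Put $F_p^0(G)=1$ and $F_p^{i+1}(G)/F_p^i(G)=F_p(G/F_p^i(G))$.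 For $p$-solvable $G$, the $p$-Fitting length $h_p(G)$ is the least positive integer $n$ with $F_p^n(G)=G$. The $p$-length $l_p(G)$ of a $p$-solvable group $G$ is the number of $p$-factors in the upper $p$-series $1=P_0(G)\le M_0(G)\le P_1(G)\le M_1(G)\le\cdots$, where $M_i(G)/P_i(G)=O_{p'}(G/P_i(G))$ and $P_{i+1}(G)/M_i(G)=O_p(G/M_i(G))$; that is, $l_p(G)$ is the least $n\ge 0$ with $M_n(G)=G$. Theorem. (1) If $G$ is $p$-solvable and $k\ge 3$ is an integer, then $h_p(G)\le k$ if and only if $h_p(G/N^\infty_{\mathscr U_p}(G))\le k$. (2) If $G$ is solvable and $k\ge 2$ is an integer, then $l_p(G)\le k$ if and only if $l_p(G/N^\infty_{\mathscr U}(G))\le k$. -/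

import Mathlib

namespace NormResidual

universe u

/-! ### Chief factors, solvability conditions and classes of groups -/

/-- `K / H` is a chief factor of `G`: `H < K` are normal subgroups of `G` and no normal subgroup
of `G` lies strictly between them. -/
structure IsChiefFactor {G : Type u} [Group G] (H K : Subgroup G) : Prop where
  normal_bot : H.Normal
  normal_top : K.Normal
  lt : H < K
  eq_or_eq : ∀ L : Subgroup G, L.Normal → H ≤ L → L ≤ K → L = H ∨ L = K

/-- A (finite) group is `p`-solvable if each chief factor is a `p`-group or a `p'`-group.
Here `H.relIndex K` is the order of `K / H`. -/
def IsPSolvable (p : ℕ) (G : Type u) [Group G] : Prop :=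
  ∀ H K : Subgroup G, IsChiefFactor H K → (∃ n : ℕ, H.relIndex K = p ^ n) ∨ ¬ p ∣ H.relIndex K

/-- A (finite) group is `p`-supersolvable if each chief factor has order `p` or is a
`p'`-group. -/
def IsPSupersolvable (p : ℕ) (G : Type u) [Group G] : Prop :=
  ∀ H K : Subgroup G, IsChiefFactor H K → H.relIndex K = p ∨ ¬ p ∣ H.relIndex K

/-- A group is supersolvable if it has a finite series of normal subgroups of the whole group
with cyclic factors: each term is generated by the preceding one and a single element. -/
def IsSupersolvable (G : Type u) [Group G] : Prop :=
  ∃ (n : ℕ) (s : ℕ → Subgroup G), s 0 = ⊥ ∧ s n = ⊤ ∧ (∀ i, (s i).Normal) ∧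
    ∀ i, i < n → ∃ x : G, s (i + 1) = s i ⊔ Subgroup.zpowers x

/-- A (finite) group is `p`-nilpotent if it has a normal `p`-complement, i.e. a normal
`p'`-subgroup whose index is a power of `p`. -/
def IsPNilpotent (p : ℕ) (G : Type u) [Group G] : Prop :=
  ∃ K : Subgroup G, K.Normal ∧ ¬ p ∣ Nat.card K ∧ ∃ n : ℕ, K.index = p ^ n

/-- A class of groups, closed under isomorphism. -/
structure GroupClass where
  Mem : ∀ (G : Type u) [Group G], Prop
  mem_of_equiv : ∀ {G H : Type u} [Group G] [Group H], G ≃* H → Mem G → Mem H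

theorem IsChiefFactor.comap_equiv {G H : Type u} [Group G] [Group H] (e : G ≃* H)
    {A B : Subgroup H} (h : IsChiefFactor A B) :
    IsChiefFactor (A.comap e.toMonoidHom) (B.comap e.toMonoidHom) := by
  have hs : Function.Surjective e.toMonoidHom := e.surjective
  refine ⟨h.normal_bot.comap _, h.normal_top.comap _,
    (Subgroup.comap_lt_comap_of_surjective hs).2 h.lt, fun L hL h1 h2 => ?_⟩
  have hLe : (L.map e.toMonoidHom).comap e.toMonoidHom = L :=
    Subgroup.comap_map_eq_self_of_injective e.injective L
  have := h.eq_or_eq (L.map e.toMonoidHom) (hL.map _ hs)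
    (by rw [← Subgroup.map_comap_eq_self_of_surjective hs A]; exact Subgroup.map_mono h1)
    (Subgroup.map_le_iff_le_comap.2 h2)
  rcases this with h' | h'
  · left; rw [← h', hLe]
  · right; rw [← h', hLe]

theorem relIndex_comap_equiv {G H : Type u} [Group G] [Group H] (e : G ≃* H)
    (A B : Subgroup H) :
    (A.comap e.toMonoidHom).relIndex (B.comap e.toMonoidHom) = A.relIndex B := by
  rw [Subgroup.relIndex_comap, Subgroup.map_comap_eq_self_of_surjective e.surjective]

theorem IsPSupersolvable.of_equiv {p : ℕ} {G H : Type u} [Group G] [Group H] (e : G ≃* H)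
    (h : IsPSupersolvable p G) : IsPSupersolvable p H := by
  intro A B hAB
  have := h _ _ (hAB.comap_equiv e)
  rwa [relIndex_comap_equiv] at this

theorem IsSupersolvable.of_equiv {G H : Type u} [Group G] [Group H] (e : G ≃* H)
    (h : IsSupersolvable G) : IsSupersolvable H := by
  obtain ⟨n, s, h0, hn, hN, hc⟩ := h
  refine ⟨n, fun i => (s i).map e.toMonoidHom, ?_, ?_, fun i => (hN i).map _ e.surjective, ?_⟩
  · simp [h0]
  · simp [hn]
  · intro i hi
    obtain ⟨x, hx⟩ := hc i hi
    refine ⟨e x, ?_⟩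
    change (s (i + 1)).map _ = (s i).map _ ⊔ _
    rw [hx, Subgroup.map_sup, MonoidHom.map_zpowers]
    rfl

/-- The class `𝒰_p` of `p`-supersolvable groups. -/
def pSupersolvableClass (p : ℕ) : GroupClass.{u} where
  Mem G _ := IsPSupersolvable p G
  mem_of_equiv e h := h.of_equiv e

/-- The class `𝒰` of supersolvable groups. -/
def supersolvableClass : GroupClass.{u} where
  Mem G _ := IsSupersolvable G
  mem_of_equiv e h := h.of_equiv e

/-! ### Ascending series -/

/-- A rule assigning to each group a normal subgroup of it. -/
abbrev NormalRule := ∀ (Q : Type u) [Group Q], {N : Subgroup Q // N.Normal}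

/-- Given a rule `c`, the full preimage in `G` of the subgroup `c (G / N)` of `G / N`. -/
def pull (c : NormalRule.{u}) {G : Type u} [Group G] (N : {N : Subgroup G // N.Normal}) :
    {N : Subgroup G // N.Normal} :=
  haveI := N.2
  ⟨(c (G ⧸ N.1)).1.comap (QuotientGroup.mk' N.1), (c (G ⧸ N.1)).2.comap _⟩

/-- The ascending series `1 = c⁰(G) ≤ c¹(G) ≤ ⋯` with `cⁱ⁺¹(G) / cⁱ(G) = c(G / cⁱ(G))`. -/
def ascend (c : NormalRule.{u}) (G : Type u) [Group G] : ℕ → {N : Subgroup G // N.Normal}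
  | 0 => ⟨⊥, inferInstance⟩
  | i + 1 => pull c (ascend c G i)

theorem sSup_normal {G : Type u} [Group G] (S : Set (Subgroup G)) (h : ∀ N ∈ S, N.Normal) :
    (sSup S).Normal := by
  rw [← Subgroup.normalizer_eq_top_iff, Subgroup.eq_top_iff']
  intro g
  rw [Subgroup.mem_normalizer_iff_map_conj_eq, (Subgroup.gc_map_comap _).l_sSup, sSup_eq_iSup]
  refine iSup_congr fun N => iSup_congr fun hN => ?_
  have := h N hN
  rw [← Subgroup.mem_normalizer_iff_map_conj_eq, Subgroup.normalizer_eq_top]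
  trivial

/-! ### The norm of a group with respect to a class -/

/-- The `𝓕`-residual `G^𝓕`: the intersection of all normal `N` with `G / N ∈ 𝓕`. -/
def residual (F : GroupClass.{u}) (G : Type u) [Group G] : Subgroup G :=
  sInf {N | ∃ _ : N.Normal, F.Mem (G ⧸ N)}

/-- The residual `T^𝓕` of a subgroup `T ≤ G`, viewed as a subgroup of `G`. -/
def residualOf (F : GroupClass.{u}) {G : Type u} [Group G] (T : Subgroup G) : Subgroup G :=
  (residual F T).map T.subtype

/-- The norm `N_𝓕(G)`: the intersection of the normalizers in `G` of the residuals `T^𝓕` of all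
subgroups `T ≤ G`. -/
def normOf (F : GroupClass.{u}) (G : Type u) [Group G] : Subgroup G :=
  ⨅ T : Subgroup G, Subgroup.normalizer (residualOf F T : Set G)

theorem residual_map_equiv_le (F : GroupClass.{u}) {G H : Type u} [Group G] [Group H]
    (e : G ≃* H) : (residual F G).map e.toMonoidHom ≤ residual F H := by
  rw [Subgroup.map_le_iff_le_comap]
  intro x hx
  simp only [residual, Subgroup.mem_comap, Subgroup.mem_sInf, Set.mem_ofPred_eq] at hx ⊢
  rintro N ⟨hN, hF⟩
  have hN' : (N.comap e.toMonoidHom).Normal := hN.comap _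
  refine hx (N.comap e.toMonoidHom) ⟨hN', F.mem_of_equiv ?_ hF⟩
  exact (QuotientGroup.congr _ N e
    (Subgroup.map_comap_eq_self_of_surjective e.surjective N)).symm

theorem residualOf_conj_le (F : GroupClass.{u}) {G : Type u} [Group G] (g : G)
    (T : Subgroup G) :
    (residualOf F T).map (MulAut.conj g).toMonoidHom ≤
      residualOf F (T.map (MulAut.conj g).toMonoidHom) := by
  rintro _ ⟨_, ⟨t, ht, rfl⟩, rfl⟩
  let e := (MulAut.conj g).subgroupMap T
  exact ⟨e t, residual_map_equiv_le F e ⟨t, ht, rfl⟩, rfl⟩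

theorem residualOf_conj (F : GroupClass.{u}) {G : Type u} [Group G] (g : G)
    (T : Subgroup G) :
    residualOf F (T.map (MulAut.conj g).toMonoidHom) =
      (residualOf F T).map (MulAut.conj g).toMonoidHom := by
  refine le_antisymm ?_ (residualOf_conj_le F g T)
  have h := residualOf_conj_le F g⁻¹ (T.map (MulAut.conj g).toMonoidHom)
  have key : ∀ S : Subgroup G,
      (S.map (MulAut.conj g).toMonoidHom).map (MulAut.conj g⁻¹).toMonoidHom = S := by
    intro S
    ext x
    simp [Subgroup.mem_map, mul_assoc]
  have key' : ∀ S : Subgroup G,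
      (S.map (MulAut.conj g⁻¹).toMonoidHom).map (MulAut.conj g).toMonoidHom = S := by
    intro S
    ext x
    simp [Subgroup.mem_map, mul_assoc]
  rw [key] at h
  have := Subgroup.map_mono (f := (MulAut.conj g).toMonoidHom) h
  rwa [key'] at this

theorem norm_normal (F : GroupClass.{u}) (G : Type u) [Group G] : (normOf F G).Normal := by
  refine ⟨fun n hn g => ?_⟩
  simp only [normOf, Subgroup.mem_iInf] at hn ⊢
  intro T
  have h := hn (T.map (MulAut.conj g⁻¹).toMonoidHom)
  rw [residualOf_conj, Subgroup.mem_normalizer_iff] at h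
  rw [Subgroup.mem_normalizer_iff]
  intro x
  have h1 := h (g⁻¹ * x * g)
  have aux : ∀ y : G, g⁻¹ * y * g ∈ (residualOf F T).map (MulAut.conj g⁻¹).toMonoidHom ↔
      y ∈ residualOf F T := by
    intro y
    simp [Subgroup.mem_map]
  rw [aux] at h1
  rw [h1, ← aux]
  simp [mul_assoc]

/-- The rule `G ↦ N_𝓕(G)`. -/
def normRule (F : GroupClass.{u}) : NormalRule.{u} := fun Q _ => ⟨normOf F Q, norm_normal F Q⟩

/-- The terminal term `N^∞_𝓕(G)` of the ascending series `N^i_𝓕(G)`, that is, the union of the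
series (for finite `G` the series is eventually constant). -/
def normInfty (F : GroupClass.{u}) (G : Type u) [Group G] : Subgroup G :=
  sSup (Set.range fun i : ℕ => (ascend (normRule F) G i).1)

instance normInfty_normal (F : GroupClass.{u}) (G : Type u) [Group G] :
    (normInfty F G).Normal :=
  sSup_normal _ (by rintro _ ⟨i, rfl⟩; exact (ascend (normRule F) G i).2)

/-! ### The `p`-Fitting length and the `p`-length -/

/-- The `p`-Fitting subgroup `F_p(G)`: the largest normal `p`-nilpotent subgroup, i.e. the
product of all normal `p`-nilpotent subgroups. -/
def pFitting (p : ℕ) : NormalRule.{u} := fun Q _ =>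
  ⟨sSup {N : Subgroup Q | N.Normal ∧ IsPNilpotent p N}, sSup_normal _ fun _ h => h.1⟩

/-- `O_p(G)`: the largest normal `p`-subgroup. -/
def pCore (p : ℕ) : NormalRule.{u} := fun Q _ =>
  ⟨sSup {N : Subgroup Q | N.Normal ∧ IsPGroup p N}, sSup_normal _ fun _ h => h.1⟩

/-- `O_{p'}(G)`: the largest normal subgroup of order prime to `p`. -/
def pPrimeCore (p : ℕ) : NormalRule.{u} := fun Q _ =>
  ⟨sSup {N : Subgroup Q | N.Normal ∧ ¬ p ∣ Nat.card N}, sSup_normal _ fun _ h => h.1⟩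

/-- The term `M_n(G)` of the upper `p`-series `1 = P₀ ≤ M₀ ≤ P₁ ≤ M₁ ≤ ⋯`, where
`M_i / P_i = O_{p'}(G / P_i)` and `P_{i+1} / M_i = O_p(G / M_i)`. -/
def upperPSeries (p : ℕ) (G : Type u) [Group G] : ℕ → {N : Subgroup G // N.Normal}
  | 0 => pull (pPrimeCore p) ⟨⊥, inferInstance⟩
  | n + 1 => pull (pPrimeCore p) (pull (pCore p) (upperPSeries p G n))

/-- The `p`-Fitting length `h_p(G)`: the least positive `n` with `F^n_p(G) = G`
(and `⊤` if there is none, which does not happen for finite `p`-solvable groups). -/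
noncomputable def pFittingLength (p : ℕ) (G : Type u) [Group G] : ℕ∞ :=
  sInf {m | ∃ n : ℕ, 0 < n ∧ (ascend (pFitting p) G n).1 = ⊤ ∧ m = (n : ℕ∞)}

/-- The `p`-length `l_p(G)`: the number of `p`-factors of the upper `p`-series, i.e. the least
`n` with `M_n(G) = G` (and `⊤` if there is none, which does not happen for finite `p`-solvable
groups). -/
noncomputable def pLength (p : ℕ) (G : Type u) [Group G] : ℕ∞ :=
  sInf {m | ∃ n : ℕ, (upperPSeries p G n).1 = ⊤ ∧ m = (n : ℕ∞)}

end NormResidual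

namespace NormResidual

universe u

/-! ### Divisibility of relative indices under meets, joins and images. -/

section Index

variable {G : Type*} [Group G]

/-! Both lengths are read off one notion, `HasSeries p β n ⊥`: a normal series of `n` pairs
(`p'`-factor, then `p`-factor) with a last factor that is trivial (`p`-Fitting length) or a
`p'`-group (`p`-length). The condition passes to quotients and is closed under intersections: series
for `G/A` and `G/A'` give one for `G/(A ∩ A')`.

The other input is that supersolvable and `p`-supersolvable groups have `p`-length at most one,
since the automorphism group of a group of order `p` has order `p - 1`. So each `T / T^𝓕` has
`p`-length at most one, and this is all that is used about the class.

It remains to lift a series from `G/N` to `G` when `N` normalizes all residuals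
(`HasSeries.bot_of_normalizesResiduals`), by induction on `|G|`. Let `M ≤ N` be minimal normal. A
`p'`-group `M` is absorbed by the first `p'`-factor. Otherwise `M` is an abelian `p`-group, and
`O_{p'}(G) = 1` may be assumed. Let `K/M` be the first `p'`-factor of a series for `G/M`; if it is
trivial, `M` merges with the next `p`-factor. If not, Schur–Zassenhaus and Frattini give a
complement `Q ≠ 1` of `M` in `K` and `G = M H` with `H = N_G(Q)`. As `M ∩ H` is normal in `G`, it is
`M` or `1`. If it is `M`, then `Q` is a nontrivial normal `p'`-subgroup, which is excluded. If it is
`1`, the residual `R` of `H` is normalized by both `M` and `H`, hence normal in `G`, and `R ∩ M =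
1`. For `R ≠ 1` the series of `G/R` and `G/M` combine. For `R = 1` the group `G/M ≅ H` has
`p`-length at most one, so `l_p(G) ≤ 2` and `h_p(G) ≤ 3`; hence the bounds on `k`. -/

theorem relIndex_dvd_relIndex_of_le_right {A S B : Subgroup G} [A.Normal] (h : S ≤ B) :
    A.relIndex S ∣ A.relIndex B := by
  rw [← Subgroup.relIndex_subgroupOf h]
  exact Subgroup.relIndex_dvd_index_of_normal _ _

theorem relIndex_inf_inf_dvd (A B : Subgroup G) [A.Normal] (C : Subgroup G) :
    (A ⊓ C).relIndex (B ⊓ C) ∣ A.relIndex B := by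
  have : (A ⊓ C).relIndex (B ⊓ C) = A.relIndex (B ⊓ C) := by
    rw [← Subgroup.inf_relIndex_right, ← Subgroup.inf_relIndex_right A]
    congr 1
    exact le_antisymm (le_inf (inf_le_left.trans inf_le_left) inf_le_right)
      (le_inf (le_inf inf_le_left (inf_le_right.trans inf_le_right)) inf_le_right)
  rw [this]
  exact relIndex_dvd_relIndex_of_le_right inf_le_left

theorem relIndex_sup_sup_dvd {A B : Subgroup G} [A.Normal] (h : A ≤ B) (N : Subgroup G)
    [N.Normal] : (A ⊔ N).relIndex (B ⊔ N) ∣ A.relIndex B := by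
  have : B ⊔ N = B ⊔ (A ⊔ N) := by rw [← sup_assoc, sup_eq_left.2 h]
  rw [this, Subgroup.relIndex_sup_right]
  exact Subgroup.relIndex_dvd_of_le_left _ le_sup_left

theorem relIndex_map_dvd {H : Type*} [Group H] (f : G →* H) {A B : Subgroup G} [A.Normal]
    (h : A ≤ B) : (A.map f).relIndex (B.map f) ∣ A.relIndex B := by
  rw [Subgroup.relIndex_map_map]
  exact relIndex_sup_sup_dvd h _

theorem relIndex_inf_inf_dvd_mul {A A' K K' : Subgroup G} [A.Normal] [A'.Normal] (h : A ≤ K)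
    (h' : A' ≤ K') :
    (A ⊓ A').relIndex (K ⊓ K') ∣ A'.relIndex K' * A.relIndex K := by
  -- The index is split through the intermediate subgroup `A ⊓ K'`.
  rw [← Subgroup.relIndex_mul_relIndex _ _ _ (inf_le_inf_left A h') (inf_le_inf_right K' h)]
  refine mul_dvd_mul ?_ (relIndex_inf_inf_dvd A K K')
  rw [inf_comm A, inf_comm A]
  exact relIndex_inf_inf_dvd A' K' A

theorem relIndex_comap_comap {H : Type*} [Group H] {f : G →* H} (hf : Function.Surjective f)
    (A B : Subgroup H) : (A.comap f).relIndex (B.comap f) = A.relIndex B := by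
  rw [Subgroup.relIndex_comap, Subgroup.map_comap_eq_self_of_surjective hf]

end Index

/-! ### Series of alternating `p'`- and `p`-factors. -/

theorem exists_eq_pow_of_dvd {p : ℕ} (hp : p.Prime) {a b : ℕ} (h : a ∣ b)
    (hb : ∃ m, b = p ^ m) : ∃ m, a = p ^ m := by
  obtain ⟨m, rfl⟩ := hb
  obtain ⟨j, -, hj⟩ := (Nat.dvd_prime_pow hp).1 h
  exact ⟨j, hj⟩

theorem exists_mul_eq_pow {p a b : ℕ} (ha : ∃ m, a = p ^ m) (hb : ∃ m, b = p ^ m) :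
    ∃ m, a * b = p ^ m := by
  obtain ⟨m, rfl⟩ := ha
  obtain ⟨n, rfl⟩ := hb
  exact ⟨m + n, (pow_add p m n).symm⟩

/-- A class of orders prime to `p`, closed under divisors and products. -/
structure IsPrimeToClass (p : ℕ) (β : ℕ → Prop) : Prop where
  one : β 1
  of_dvd : ∀ {a b : ℕ}, a ∣ b → β b → β a
  mul : ∀ {a b : ℕ}, β a → β b → β (a * b)
  not_dvd : ∀ {a : ℕ}, β a → ¬ p ∣ a

theorem isPrimeToClass_eq_one {p : ℕ} (hp : p.Prime) : IsPrimeToClass p (· = 1) where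
  one := rfl
  of_dvd h hb := Nat.dvd_one.1 (hb ▸ h)
  mul ha hb := by subst ha hb; rfl
  not_dvd ha h := hp.one_lt.ne' (Nat.dvd_one.1 (ha ▸ h))

theorem isPrimeToClass_not_dvd {p : ℕ} (hp : p.Prime) : IsPrimeToClass p (fun a => ¬ p ∣ a) where
  one h := hp.one_lt.ne' (Nat.dvd_one.1 h)
  of_dvd h hb ha := hb (ha.trans h)
  mul ha hb h := (hp.dvd_mul.1 h).elim ha hb
  not_dvd h := h

/-- There is a chain of normal subgroups from `A` to `G` with `n` pairs of a `p'`-factor followed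
by a `p`-factor, and a last factor whose order lies in `β`. -/
def HasSeries (p : ℕ) (β : ℕ → Prop) {G : Type*} [Group G] : ℕ → Subgroup G → Prop
  | 0, A => β A.index
  | n + 1, A => ∃ K B : Subgroup G, K.Normal ∧ B.Normal ∧ A ≤ K ∧ K ≤ B ∧
      ¬ p ∣ A.relIndex K ∧ (∃ m, K.relIndex B = p ^ m) ∧ HasSeries p β n B

namespace HasSeries

variable {p : ℕ} {β : ℕ → Prop} {G : Type*} [Group G]

theorem map (hp : p.Prime) (hβ : IsPrimeToClass p β) {H : Type*} [Group H] {f : G →* H}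
    (hf : Function.Surjective f) : ∀ (n : ℕ) {A : Subgroup G} [A.Normal],
    HasSeries p β n A → HasSeries p β n (A.map f)
  | 0, _, _, h => hβ.of_dvd (Subgroup.index_map_dvd _ hf) h
  | n + 1, _, _, ⟨K, B, hK, hB, hAK, hKB, h1, h2, h3⟩ =>
    ⟨K.map f, B.map f, hK.map f hf, hB.map f hf, Subgroup.map_mono hAK, Subgroup.map_mono hKB,
      fun h => h1 (h.trans (relIndex_map_dvd f hAK)),
      exists_eq_pow_of_dvd hp (relIndex_map_dvd f hKB) h2, h3.map hp hβ hf n⟩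

theorem comap {H : Type*} [Group H] {f : G →* H} (hf : Function.Surjective f) :
    ∀ (n : ℕ) {A : Subgroup H}, HasSeries p β n A → HasSeries p β n (A.comap f)
  | 0, A, h => by rwa [HasSeries, Subgroup.index_comap_of_surjective A hf]
  | n + 1, A, ⟨K, B, hK, hB, hAK, hKB, h1, h2, h3⟩ =>
    ⟨K.comap f, B.comap f, hK.comap f, hB.comap f, Subgroup.comap_mono hAK,
      Subgroup.comap_mono hKB, by rwa [relIndex_comap_comap hf], by rwa [relIndex_comap_comap hf],
      h3.comap hf n⟩

/-- The two series are intersected term by term; each new factor has order dividing the product of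
the two old ones. -/
theorem inf (hp : p.Prime) (hβ : IsPrimeToClass p β) : ∀ (n : ℕ) {A A' : Subgroup G} [A.Normal]
    [A'.Normal], HasSeries p β n A → HasSeries p β n A' → HasSeries p β n (A ⊓ A')
  | 0, A, A', _, _, h, h' => by
    refine hβ.of_dvd ?_ (hβ.mul h' h)
    simpa only [← Subgroup.relIndex_top_right, inf_top_eq] using
      relIndex_inf_inf_dvd_mul (A := A) (A' := A') le_top le_top
  | n + 1, A, A', _, _, ⟨K, B, hK, hB, hAK, hKB, h1, h2, h3⟩,
      ⟨K', B', hK', hB', hAK', hKB', h1', h2', h3'⟩ =>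
    ⟨K ⊓ K', B ⊓ B', inferInstance, inferInstance, inf_le_inf hAK hAK', inf_le_inf hKB hKB',
      fun h => (hp.dvd_mul.1 (h.trans (relIndex_inf_inf_dvd_mul hAK hAK'))).elim h1' h1,
      exists_eq_pow_of_dvd hp (relIndex_inf_inf_dvd_mul hKB hKB') (exists_mul_eq_pow h2' h2),
      h3.inf hp hβ n h3'⟩

theorem mono (hp : p.Prime) (hβ : IsPrimeToClass p β) : ∀ (n : ℕ) {A N : Subgroup G} [A.Normal]
    [N.Normal], A ≤ N → HasSeries p β n A → HasSeries p β n N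
  | 0, A, N, _, _, hAN, h => hβ.of_dvd (Subgroup.index_dvd_of_le hAN) h
  | n + 1, A, N, _, _, hAN, ⟨K, B, hK, hB, hAK, hKB, h1, h2, h3⟩ => by
    refine ⟨K ⊔ N, B ⊔ N, inferInstance, inferInstance, le_sup_right, sup_le_sup_right hKB N,
      fun h => h1 (h.trans ?_), exists_eq_pow_of_dvd hp (relIndex_sup_sup_dvd hKB N) h2,
      h3.mono hp hβ n le_sup_left⟩
    have := relIndex_sup_sup_dvd hAK N
    rwa [sup_eq_right.2 hAN] at this

theorem succ (hp : p.Prime) {n : ℕ} {A : Subgroup G} [hA : A.Normal] (h : HasSeries p β n A) :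
    HasSeries p β (n + 1) A :=
  ⟨A, A, hA, hA, le_rfl, le_rfl, by
    rw [Subgroup.relIndex_self]; exact (isPrimeToClass_not_dvd hp).one,
    ⟨0, by rw [Subgroup.relIndex_self, pow_zero]⟩, h⟩

theorem of_le (hp : p.Prime) {m n : ℕ} (hmn : m ≤ n) {A : Subgroup G} [A.Normal]
    (h : HasSeries p β m A) : HasSeries p β n A := by
  induction n, hmn using Nat.le_induction with
  | base => exact h
  | succ n _ ih => exact ih.succ hp

/-- The extra `p'`-section is merged into the first `p'`-factor. A series of length zero may have no
such factor, so `1 ≤ n` is required. -/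
theorem of_not_dvd_relIndex (hp : p.Prime) {n : ℕ} (hn : 1 ≤ n)
    {A M : Subgroup G} (hAM : A ≤ M) (hpM : ¬ p ∣ A.relIndex M)
    (h : HasSeries p β n M) : HasSeries p β n A := by
  obtain ⟨n, rfl⟩ := Nat.exists_eq_add_of_le' hn
  obtain ⟨K, B, hK, hB, hMK, hKB, h1, h2, h3⟩ := h
  refine ⟨K, B, hK, hB, hAM.trans hMK, hKB, ?_, h2, h3⟩
  rw [← Subgroup.relIndex_mul_relIndex _ _ _ hAM hMK]
  exact (isPrimeToClass_not_dvd hp).mul hpM h1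

end HasSeries

end NormResidual

namespace NormResidual

universe u

/-! ### Schur–Zassenhaus and Frattini for an abelian normal subgroup. -/

section Complements

open Subgroup
open scoped Pointwise

/-- For `x ∈ C`, the image of `φ x` in `G ⧸ C` has order dividing both `|C|` and the index. -/
theorem characteristic_of_coprime {G : Type*} [Group G] [Finite G] (C : Subgroup G)
    [C.Normal] (h : (Nat.card C).Coprime C.index) : C.Characteristic := by
  refine characteristic_iff_map_le.2 fun φ => ?_
  rintro _ ⟨x, hx, rfl⟩
  rw [← QuotientGroup.eq_one_iff, ← orderOf_eq_one_iff]
  refine Nat.eq_one_of_dvd_coprimes h ?_ ?_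
  · refine (orderOf_map_dvd (QuotientGroup.mk' C) _).trans ?_
    refine (orderOf_map_dvd φ.toMonoidHom _).trans ?_
    exact C.orderOf_dvd_natCard hx
  · rw [index_eq_card]
    exact orderOf_dvd_natCard _

/-- The class of a complement `Q` of `M` among the transversals of `M`. -/
def complementClass {G : Type*} [Group G] {M Q : Subgroup G} [M.FiniteIndex]
    [IsMulCommutative M] (h : IsComplement' Q M) : M.QuotientDiff :=
  Quotient.mk'' ⟨(Q : Set G), h⟩

/-- `Q` fixes itself under translation, so it lies in the stabilizer; the stabilizer is also a
complement of `M`, so the orders agree. Conjugacy of complements then follows from transitivity of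
`M` on `M.QuotientDiff`. -/
theorem stabilizer_eq_of_isComplement' {G : Type*} [Group G] [Finite G] {M Q : Subgroup G}
    [M.Normal] [IsMulCommutative M] (hM : (Nat.card M).Coprime M.index)
    (h : IsComplement' Q M) :
    MulAction.stabilizer G (complementClass h) = Q := by
  symm
  refine eq_of_le_of_card_ge (fun q hq => ?_) ?_
  · rw [MulAction.mem_stabilizer_iff]
    refine congrArg (Quotient.mk'' : M.LeftTransversal → M.QuotientDiff) (Subtype.ext ?_)
    change MulOpposite.op q⁻¹ • (Q : Set G) = Q
    exact op_smul_coe_set (Q.inv_mem hq)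
  · refine le_of_mul_le_mul_left (a := Nat.card M) ?_ Nat.card_pos
    rw [(isComplement'_stabilizer_of_coprime hM).card_mul_card, h.symm.card_mul_card]

theorem exists_conj_of_isComplement' {G : Type*} [Group G] [Finite G] {M Q Q' : Subgroup G}
    [M.Normal] [IsMulCommutative M] (hM : (Nat.card M).Coprime M.index)
    (h : IsComplement' M Q) (h' : IsComplement' M Q') :
    ∃ m ∈ M, Q' = Q.map (MulAut.conj m).toMonoidHom := by
  obtain ⟨m, hm⟩ := exists_smul_eq hM (complementClass h.symm) (complementClass h'.symm)
  refine ⟨m, m.2, ?_⟩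
  rw [← stabilizer_eq_of_isComplement' hM h'.symm, ← hm]
  conv_rhs => rw [← stabilizer_eq_of_isComplement' hM h.symm]
  exact MulAction.stabilizer_smul_eq_stabilizer_map_conj (m : G) _

/-- The Schur–Zassenhaus theorem for an abelian normal subgroup, together with the Frattini
argument. -/
theorem exists_complement_sup_normalizer_eq_top {G : Type*} [Group G] [Finite G]
    {M K : Subgroup G} [M.Normal] [K.Normal] [IsMulCommutative M] (hMK : M ≤ K)
    (hM : (Nat.card M).Coprime (M.relIndex K)) :
    ∃ Q : Subgroup G, M ⊓ Q = ⊥ ∧ M ⊔ Q = K ∧ M ⊔ normalizer (Q : Set G) = ⊤ := by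
  have hcard : Nat.card (M.subgroupOf K) = Nat.card M :=
    Nat.card_congr (subgroupOfEquivOfLe hMK).toEquiv
  have hM' : (Nat.card (M.subgroupOf K)).Coprime (M.subgroupOf K).index := by
    rwa [hcard]
  have hmap : (M.subgroupOf K).map K.subtype = M := map_subgroupOf_eq_of_le hMK
  obtain ⟨Q, hQ⟩ := exists_right_complement'_of_coprime hM'
  have hdisj := hQ.isCompl.inf_eq_bot
  refine ⟨Q.map K.subtype, ?_, ?_, ?_⟩
  · conv_lhs => rw [← hmap]
    rw [← map_inf_eq _ _ _ K.subtype_injective, hdisj, Subgroup.map_bot]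
  · conv_lhs => rw [← hmap]
    rw [← Subgroup.map_sup, hQ.isCompl.sup_eq_top, ← MonoidHom.range_eq_map, K.range_subtype]
  · refine eq_top_iff.2 fun g _ => ?_
    -- The conjugate of `Q` by any `g` is again a complement in `K`, hence conjugate to `Q` by some
    -- `m ∈ M`; then `m⁻¹ g` normalizes `Q`.
    have hc : IsComplement' (M.subgroupOf K)
        (Q.map (MulAut.conjNormal g : MulAut K).toMonoidHom) := by
      refine isComplement'_of_card_mul_and_disjoint ?_ ?_
      · rw [card_map_of_injective (MulEquiv.injective _), hQ.card_mul_card]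
      · rw [disjoint_iff, eq_bot_iff]
        rintro _ ⟨hx, y, hy, rfl⟩
        have hyM : y ∈ M.subgroupOf K := by
          rw [mem_subgroupOf]
          have : g * (y : G) * g⁻¹ ∈ M := hx
          have h2 := (inferInstance : M.Normal).conj_mem _ this g⁻¹
          simpa only [inv_inv, mul_assoc, inv_mul_cancel_left, inv_mul_cancel, mul_one] using h2
        have : y = 1 := by
          have : y ∈ M.subgroupOf K ⊓ Q := ⟨hyM, hy⟩
          rwa [hdisj, mem_bot] at this
        simp [this]
    obtain ⟨m, hm, he⟩ := exists_conj_of_isComplement' hM' hQ hc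
    have hmg : (m : G)⁻¹ * g ∈ normalizer ((Q.map K.subtype : Subgroup G) : Set G) := by
      have e : (Q.map K.subtype).map (MulAut.conj g).toMonoidHom =
          (Q.map K.subtype).map (MulAut.conj (m : G)).toMonoidHom := by
        have := congrArg (Subgroup.map K.subtype) he
        rw [Subgroup.map_map, Subgroup.map_map] at this
        rw [Subgroup.map_map, Subgroup.map_map]
        exact this
      rw [mem_normalizer_iff_map_conj_eq, map_mul]
      change (Q.map K.subtype).map ((MulAut.conj (m : G)⁻¹).toMonoidHom.comp
        (MulAut.conj g).toMonoidHom) = _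
      rw [← Subgroup.map_map, e, Subgroup.map_map]
      convert Subgroup.map_id _
      ext x
      simp [mul_assoc]
    have := mul_mem_sup (show (m : G) ∈ M from hm) hmg
    rwa [mul_inv_cancel_left] at this

end Complements

/-! ### Chief factors and the inherited normalizing condition. -/

section Chief

open Subgroup

theorem exists_minimal_normal {G : Type*} [Group G] [Finite G] {N : Subgroup G} [hN : N.Normal]
    (hne : N ≠ ⊥) : ∃ M ≤ N, IsChiefFactor ⊥ M := by
  obtain ⟨M, hM⟩ := (Set.toFinite {M : Subgroup G | M.Normal ∧ M ≠ ⊥ ∧ M ≤ N}).exists_minimal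
    ⟨N, hN, hne, le_rfl⟩
  obtain ⟨hMn, hM0, hMN⟩ := hM.prop
  refine ⟨M, hMN, inferInstance, hMn, bot_lt_iff_ne_bot.2 hM0, fun L hL _ hLM => ?_⟩
  by_cases h : L = ⊥
  · exact Or.inl h
  · exact Or.inr (hM.eq_of_le ⟨hL, h, hLM.trans hMN⟩ hLM)

theorem IsChiefFactor.comap {G H : Type*} [Group G] [Group H] {f : G →* H}
    (hf : Function.Surjective f) {A B : Subgroup H} (h : IsChiefFactor A B) :
    IsChiefFactor (A.comap f) (B.comap f) := by
  refine ⟨h.normal_bot.comap _, h.normal_top.comap _, (comap_lt_comap_of_surjective hf).2 h.lt,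
    fun L hL h1 h2 => ?_⟩
  have hLe : (L.map f).comap f = L :=
    comap_map_eq_self ((comap_mono bot_le).trans h1)
  refine (h.eq_or_eq (L.map f) (hL.map _ hf) ?_ (map_le_iff_le_comap.2 h2)).imp
    (fun h' => by rw [← h', hLe]) (fun h' => by rw [← h', hLe])
  rw [← map_comap_eq_self_of_surjective hf A]
  exact map_mono h1

theorem IsPSolvable.of_surjective {p : ℕ} {G H : Type*} [Group G] [Group H] {f : G →* H}
    (hf : Function.Surjective f) (h : IsPSolvable p G) : IsPSolvable p H := fun A B hAB => by
  simpa only [relIndex_comap_comap hf] using h _ _ (hAB.comap hf)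

theorem IsPSupersolvable.of_surjective {p : ℕ} {G H : Type*} [Group G] [Group H] {f : G →* H}
    (hf : Function.Surjective f) (h : IsPSupersolvable p G) : IsPSupersolvable p H :=
  fun A B hAB => by simpa only [relIndex_comap_comap hf] using h _ _ (hAB.comap hf)

theorem IsChiefFactor.isMulCommutative_of_isPGroup {p : ℕ} (hp : p.Prime) {G : Type*} [Group G]
    [Finite G] {M : Subgroup G} (hM : IsChiefFactor ⊥ M) (h : IsPGroup p M) :
    IsMulCommutative M := by
  have := Fact.mk hp
  have := hM.normal_top
  have : Nontrivial M := nontrivial_iff_ne_bot _ |>.2 hM.lt.ne'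
  -- The center of `M` is nontrivial and characteristic in `M`, so minimality forces it to be `M`.
  have hc := h.center_nontrivial
  rcases hM.eq_or_eq ((center M).map M.subtype) inferInstance bot_le (map_subtype_le _) with h | h
  · rw [map_eq_bot_iff_of_injective _ M.subtype_injective] at h
    exact absurd h ((nontrivial_iff_ne_bot _).1 hc)
  · refine center_eq_top_iff.1 (map_injective M.subtype_injective ?_)
    rw [h, ← MonoidHom.range_eq_map, M.range_subtype]

end Chief

/-- Each subgroup `T` has a normal subgroup that is normalized by `N` and whose quotient has
`p`-length at most one. -/
def NormalizesResiduals (p : ℕ) {G : Type*} [Group G] (N : Subgroup G) : Prop :=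
  ∀ T : Subgroup G, ∃ R : Subgroup T, R.Normal ∧ HasSeries p (fun a => ¬ p ∣ a) 1 R ∧
    N ≤ Subgroup.normalizer (R.map T.subtype : Set G)

/-- Asking only for some suitable `R`, not for the residual itself, makes the condition inheritable:
the image of the `R` chosen for the preimage of `T` serves for `T`. -/
theorem NormalizesResiduals.map {p : ℕ} (hp : p.Prime) {G H : Type*} [Group G] [Group H]
    {f : G →* H} (hf : Function.Surjective f) {N : Subgroup G} (h : NormalizesResiduals p N) :
    NormalizesResiduals p (N.map f) := by
  intro T
  obtain ⟨R, hR, hs, hn⟩ := h (T.comap f)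
  have hfT := f.subgroupComap_surjective_of_surjective T hf
  refine ⟨R.map (f.subgroupComap T), hR.map _ hfT,
    hs.map hp (isPrimeToClass_not_dvd hp) hfT, ?_⟩
  have : (R.map (f.subgroupComap T)).map T.subtype = (R.map (T.comap f).subtype).map f := by
    rw [Subgroup.map_map, Subgroup.map_map]; rfl
  rw [this]
  exact (Subgroup.map_mono hn).trans (Subgroup.le_normalizer_map f)

end NormResidual

namespace NormResidual

universe u

/-! ### The inductive lifting of a series through a normal subgroup. -/

open Subgroup

variable {p : ℕ} {β : ℕ → Prop}

theorem HasSeries.of_quotient {G : Type u} [Group G] {n : ℕ} {M : Subgroup G} [M.Normal]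
    (h : HasSeries p β n (⊥ : Subgroup (G ⧸ M))) : HasSeries p β n M := by
  have := h.comap (QuotientGroup.mk'_surjective M)
  rwa [MonoidHom.comap_bot, QuotientGroup.ker_mk'] at this

theorem HasSeries.quotient (hp : p.Prime) (hβ : IsPrimeToClass p β) {G : Type u} [Group G] {n : ℕ}
    {M : Subgroup G} [M.Normal] (h : HasSeries p β n M) :
    HasSeries p β n (⊥ : Subgroup (G ⧸ M)) := by
  have := h.map hp hβ (QuotientGroup.mk'_surjective M)
  rwa [QuotientGroup.map_mk'_self] at this

theorem card_quotient_lt {G : Type u} [Group G] [Finite G] {M : Subgroup G} (hM : M ≠ ⊥) :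
    Nat.card (G ⧸ M) < Nat.card G := by
  rw [card_eq_card_quotient_mul_card_subgroup M]
  exact lt_mul_of_one_lt_right Nat.card_pos ((one_lt_card_iff_ne_bot M).2 hM)

theorem normal_of_sup_eq_top {G : Type u} [Group G] {R M H : Subgroup G} (h : M ⊔ H = ⊤)
    (hM : M ≤ normalizer (R : Set G)) (hH : H ≤ normalizer (R : Set G)) : R.Normal :=
  normalizer_eq_top_iff.1 (top_le_iff.1 (h ▸ sup_le hM hH))

/-- The heart of the induction. `hquot` is the inductive hypothesis for proper quotients, pulled
back to `G`; `hbase` serves the case where the subgroup `R` chosen for the complement of `M` is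
trivial. -/
theorem HasSeries.bot_of_abelian_pGroup (hp : p.Prime) (hβ : IsPrimeToClass p β) {n : ℕ}
    (hn : 1 ≤ n) {G : Type u} [Group G] [Finite G]
    (hbase : ∀ M : Subgroup G, M.Normal → IsPGroup p M →
      HasSeries p (fun a => ¬ p ∣ a) 1 M → HasSeries p β n (⊥ : Subgroup G))
    (hquot : ∀ M : Subgroup G, M.Normal → M ≠ ⊥ → HasSeries p β n M)
    {M : Subgroup G} (hM : IsChiefFactor ⊥ M) (hpM : IsPGroup p M)
    (hR : NormalizesResiduals p M) : HasSeries p β n (⊥ : Subgroup G) := by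
  have := Fact.mk hp
  have hMn := hM.normal_top
  have hcomm := hM.isMulCommutative_of_isPGroup hp hpM
  obtain ⟨j, hj⟩ := IsPGroup.iff_card.1 hpM
  by_cases hpp : ∃ L : Subgroup G, L.Normal ∧ L ≠ ⊥ ∧ ¬ p ∣ Nat.card L
  · obtain ⟨L, hL, hL0, hpL⟩ := hpp
    exact (hquot L hL hL0).of_not_dvd_relIndex hp hn bot_le (by rwa [relIndex_bot_left])
  push Not at hpp
  obtain ⟨n, rfl⟩ := Nat.exists_eq_add_of_le' hn
  obtain ⟨K, B, hK, hB, hMK, hKB, h1, h2, h3⟩ := hquot M hMn hM.lt.ne'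
  rcases hMK.eq_or_lt with rfl | hlt
  -- With `K = M`, both `M` and `B / M` are `p`-groups, so `B` itself is the first `p`-factor.
  · refine ⟨⊥, B, inferInstance, hB, le_rfl, bot_le, ?_, ?_, h3⟩
    · rw [relIndex_self]; exact (isPrimeToClass_not_dvd hp).one
    · rw [← relIndex_mul_relIndex _ _ _ bot_le hKB, relIndex_bot_left]
      exact exists_mul_eq_pow ⟨j, hj⟩ h2
  have hco : (Nat.card M).Coprime (M.relIndex K) := by
    rw [hj]; exact ((Nat.Prime.coprime_iff_not_dvd hp).2 h1).pow_left j
  obtain ⟨Q, hMQ, hsup, hfrat⟩ := exists_complement_sup_normalizer_eq_top hMK hco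
  have hQ0 : Q ≠ ⊥ := by
    rintro rfl
    rw [sup_bot_eq] at hsup
    exact hlt.ne hsup
  have hQp : ¬ p ∣ Nat.card Q := by
    have : M.relIndex K = Nat.card Q := by
      rw [← hsup, sup_comm, relIndex_sup_right, ← inf_relIndex_right, hMQ, relIndex_bot_left]
    rwa [← this]
  set H := normalizer (Q : Set G) with hH
  have hMH : (M ⊓ H).Normal := by
    refine normal_of_sup_eq_top hfrat ?_ ?_
    · rw [le_normalizer_iff]
      rintro m hm x ⟨hx, hx'⟩
      have : m * x = x * m := congrArg Subtype.val (mul_comm' (⟨m, hm⟩ : M) ⟨x, hx⟩)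
      rw [this, mul_inv_cancel_right]
      exact ⟨hx, hx'⟩
    · rw [le_normalizer_iff]
      rintro h hh x ⟨hx, hx'⟩
      exact ⟨hMn.conj_mem x hx h, H.mul_mem (H.mul_mem hh hx') (H.inv_mem hh)⟩
  rcases hM.eq_or_eq _ hMH bot_le inf_le_left with hbot | htop
  · obtain ⟨R, hRn, hRs, hRM⟩ := hR H
    have hRnorm : (R.map H.subtype).Normal := by
      refine normal_of_sup_eq_top hfrat hRM ?_
      have := le_normalizer_map H.subtype (H := R)
      rwa [normalizer_eq_top, ← MonoidHom.range_eq_map, H.range_subtype] at this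
    by_cases hR0 : R.map H.subtype = ⊥
    · refine hbase M hMn hpM ?_
      rw [map_eq_bot_iff_of_injective _ H.subtype_injective] at hR0
      subst hR0
      -- Since `M H = G`, the quotient `G ⧸ M` is an image of `H` and inherits its series of length
      -- one.
      have hs : Function.Surjective ((QuotientGroup.mk' M).comp H.subtype) := by
        rw [← MonoidHom.range_eq_top, MonoidHom.range_comp, H.range_subtype, eq_top_iff,
          ← map_top_of_surjective _ (QuotientGroup.mk'_surjective M), ← hfrat, Subgroup.map_sup,
          QuotientGroup.map_mk'_self, bot_sup_eq]
      have := hRs.map hp (isPrimeToClass_not_dvd hp) hs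
      rw [Subgroup.map_bot] at this
      exact this.of_quotient
    · have := (hquot _ hRnorm hR0).inf hp hβ _ (hquot M hMn hM.lt.ne')
      have hz : R.map H.subtype ⊓ M = ⊥ := by
        rw [eq_bot_iff, ← hbot, inf_comm]
        exact inf_le_inf_left M (map_subtype_le R)
      rwa [hz] at this
  · have hMleH : M ≤ H := inf_eq_left.1 htop
    rw [sup_eq_right.2 hMleH] at hfrat
    exact absurd (hpp Q (normalizer_eq_top_iff.1 hfrat) hQ0) hQp

theorem HasSeries.bot_of_normalizesResiduals (hp : p.Prime) (hβ : IsPrimeToClass p β) {n : ℕ}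
    (hn : 1 ≤ n)
    (hbase : ∀ (G : Type u) [Group G] [Finite G] (M : Subgroup G), M.Normal → IsPGroup p M →
      HasSeries p (fun a => ¬ p ∣ a) 1 M → HasSeries p β n (⊥ : Subgroup G))
    {G : Type u} [Group G] [Finite G] (hG : IsPSolvable p G) {N : Subgroup G} [hN : N.Normal]
    (hR : NormalizesResiduals p N) (h : HasSeries p β n N) :
    HasSeries p β n (⊥ : Subgroup G) := by
  induction hc : Nat.card G using Nat.strong_induction_on generalizing G with
  | _ c ih =>
    by_cases hN0 : N = ⊥
    · rwa [← hN0]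
    have hquot : ∀ M : Subgroup G, M.Normal → M ≠ ⊥ → HasSeries p β n M := by
      intro M hM hM0
      have hs := QuotientGroup.mk'_surjective M
      have := hN.map _ hs
      exact (ih _ (hc ▸ card_quotient_lt hM0) (hG.of_surjective hs) (hR.map hp hs)
        (h.map hp hβ hs) rfl).of_quotient
    obtain ⟨M, hMN, hM⟩ := exists_minimal_normal hN0
    have hor := hG _ _ hM
    rcases hor with ⟨j, hj⟩ | hpM
    · rw [relIndex_bot_left] at hj
      refine HasSeries.bot_of_abelian_pGroup hp hβ hn (fun M => hbase G M) hquot hM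
        (IsPGroup.of_card hj) fun T => ?_
      obtain ⟨R, h1, h2, h3⟩ := hR T
      exact ⟨R, h1, h2, hMN.trans h3⟩
    · exact (hquot M hM.normal_top hM.lt.ne').of_not_dvd_relIndex hp hn bot_le hpM

end NormResidual

namespace NormResidual

universe u

open Subgroup

/-! ### Supersolvable and `p`-supersolvable groups have `p`-length at most one. -/

section LengthOne

variable {p : ℕ}

theorem not_dvd_index_centralizer (hp : p.Prime) {G : Type*} [Group G] [Finite G]
    {M : Subgroup G} [M.Normal] (hM : Nat.card M = p) :
    ¬ p ∣ (centralizer (M : Set G)).index := by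
  have := Fact.mk hp
  have hcyc : IsCyclic M := isCyclic_of_prime_card hM
  have hle : (MulAut.conjNormal : G →* MulAut M).ker ≤ centralizer (M : Set G) := by
    intro g hg
    rw [mem_centralizer_iff]
    intro m hm
    have := congrArg Subtype.val (DFunLike.congr_fun (MonoidHom.mem_ker.1 hg) ⟨m, hm⟩)
    rw [MulAut.conjNormal_apply, MulAut.one_apply] at this
    exact (mul_inv_eq_iff_eq_mul.1 this).symm
  intro h
  have h1 : p ∣ Nat.card (MulAut M) :=
    (h.trans (index_dvd_of_le hle)).trans (by rw [index_ker]; exact card_subgroup_dvd_card _)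
  rw [IsCyclic.card_mulAut, hM, Nat.totient_prime hp] at h1
  exact Nat.not_dvd_of_pos_of_lt (Nat.sub_pos_of_lt hp.one_lt) (Nat.sub_lt hp.pos one_pos) h1

/-- Intersecting the series with `C = C_G(M)` costs only a `p'`-index and makes `M` central in `K ⊓
C`. A complement `Q` there is centralized by `M`, hence normal in `G`, and `M` moves up into the
`p`-factor `(B ⊓ C) / Q`. -/
theorem HasSeries.one_bot_of_card_eq (hp : p.Prime) {G : Type*} [Group G] [Finite G]
    {M : Subgroup G} [hMn : M.Normal] (hM : Nat.card M = p)
    (h : HasSeries p (fun a => ¬ p ∣ a) 1 M) :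
    HasSeries p (fun a => ¬ p ∣ a) 1 (⊥ : Subgroup G) := by
  have := Fact.mk hp
  have hcyc : IsCyclic M := isCyclic_of_prime_card hM
  have hcomm : IsMulCommutative M := hcyc.isMulCommutative
  obtain ⟨K, B, hK, hB, hMK, hKB, h1, h2, h3⟩ := h
  set C := centralizer (M : Set G) with hC
  have hMC : M ≤ C := le_centralizer M
  have h1' : ¬ p ∣ M.relIndex (K ⊓ C) := fun h =>
    h1 (h.trans (relIndex_dvd_relIndex_of_le_right inf_le_left))
  obtain ⟨Q, hMQ, hsup, hfrat⟩ := exists_complement_sup_normalizer_eq_top (K := K ⊓ C)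
    (le_inf hMK hMC) (by rw [hM]; exact (Nat.Prime.coprime_iff_not_dvd hp).2 h1')
  have hQK : Q ≤ K ⊓ C := hsup ▸ le_sup_right
  have hQ : Q.Normal := by
    refine normal_of_sup_eq_top hfrat (le_normalizer_iff.2 fun m hm q hq => ?_) le_rfl
    rwa [(mem_centralizer_iff.1 (hQK hq).2 m hm), mul_inv_cancel_right]
  refine ⟨Q, B ⊓ C, hQ, inferInstance, bot_le, hQK.trans (inf_le_inf_right C hKB), ?_, ?_, ?_⟩
  · have : M.relIndex (K ⊓ C) = Nat.card Q := by
      rw [← hsup, sup_comm, relIndex_sup_right, ← inf_relIndex_right, hMQ, relIndex_bot_left]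
    rwa [relIndex_bot_left, ← this]
  · rw [← relIndex_mul_relIndex _ _ _ hQK (inf_le_inf_right C hKB)]
    refine exists_mul_eq_pow ⟨1, ?_⟩ (exists_eq_pow_of_dvd hp (relIndex_inf_inf_dvd K B C) h2)
    rw [← hsup, relIndex_sup_right, ← inf_relIndex_right, inf_comm, hMQ, relIndex_bot_left, hM,
      pow_one]
  · intro h
    have hd := relIndex_inf_inf_dvd_mul (le_top : B ≤ ⊤) (le_top : C ≤ ⊤)
    rw [inf_top_eq, relIndex_top_right, relIndex_top_right, relIndex_top_right] at hd
    exact (hp.dvd_mul.1 (h.trans hd)).elim (not_dvd_index_centralizer hp hM) h3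

theorem HasSeries.one_bot_of_quotient_closed (hp : p.Prime)
    (P : ∀ (G : Type u) [Group G], Prop)
    (hquot : ∀ {G : Type u} [Group G] (M : Subgroup G) [M.Normal], P G → P (G ⧸ M))
    (hex : ∀ {G : Type u} [Group G] [Finite G] [Nontrivial G], P G →
      ∃ M : Subgroup G, M.Normal ∧ M ≠ ⊥ ∧ (Nat.card M = p ∨ ¬ p ∣ Nat.card M))
    {G : Type u} [Group G] [Finite G] (h : P G) :
    HasSeries p (fun a => ¬ p ∣ a) 1 (⊥ : Subgroup G) := by
  induction hc : Nat.card G using Nat.strong_induction_on generalizing G with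
  | _ c ih =>
    have hβ := isPrimeToClass_not_dvd hp
    rcases subsingleton_or_nontrivial G with hs | hnt
    · refine HasSeries.succ hp (?_ : ¬ p ∣ _)
      rw [index_bot, Nat.card_unique]
      exact hβ.one
    · obtain ⟨M, hM, hM0, hor⟩ := hex h
      have hs := (ih _ (hc ▸ card_quotient_lt hM0) (hquot M h) rfl).of_quotient
      rcases hor with hor | hor
      · exact hs.one_bot_of_card_eq hp hor
      · exact hs.of_not_dvd_relIndex hp le_rfl bot_le (by rwa [relIndex_bot_left])

theorem IsPSupersolvable.hasSeries (hp : p.Prime) {G : Type u} [Group G] [Finite G]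
    (h : IsPSupersolvable p G) : HasSeries p (fun a => ¬ p ∣ a) 1 (⊥ : Subgroup G) := by
  refine HasSeries.one_bot_of_quotient_closed hp (fun G _ => IsPSupersolvable p G)
    (fun M _ h => h.of_surjective (QuotientGroup.mk'_surjective M)) (fun {G} _ _ _ h => ?_) h
  obtain ⟨M, -, hM⟩ := exists_minimal_normal (top_ne_bot : (⊤ : Subgroup G) ≠ ⊥)
  refine ⟨M, hM.normal_top, hM.lt.ne', ?_⟩
  have := h _ _ hM
  rwa [relIndex_bot_left] at this

theorem IsSupersolvable.of_surjective {G H : Type*} [Group G] [Group H] {f : G →* H}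
    (hf : Function.Surjective f) (h : IsSupersolvable G) : IsSupersolvable H := by
  obtain ⟨n, s, h0, hn, hN, hc⟩ := h
  refine ⟨n, fun i => (s i).map f, by simp [h0], ?_, fun i => (hN i).map _ hf, fun i hi => ?_⟩
  · change (s n).map f = ⊤
    rw [hn, map_top_of_surjective f hf]
  · obtain ⟨x, hx⟩ := hc i hi
    refine ⟨f x, ?_⟩
    change (s (i + 1)).map f = (s i).map f ⊔ _
    rw [hx, Subgroup.map_sup, MonoidHom.map_zpowers]

theorem zpowers_pow_normal {G : Type*} [Group G] {x : G} (h : (zpowers x).Normal) (n : ℕ) :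
    (zpowers (x ^ n)).Normal := by
  refine ⟨?_⟩
  rintro _ ⟨k, rfl⟩ g
  obtain ⟨j, hj⟩ := mem_zpowers_iff.1 (h.conj_mem x (mem_zpowers x) g)
  refine mem_zpowers_iff.2 ⟨j * k, ?_⟩
  change _ = g * (x ^ n) ^ k * g⁻¹
  rw [← conj_zpow, ← conj_pow, ← hj, ← zpow_natCast, ← zpow_natCast, ← zpow_mul, ← zpow_mul,
    ← zpow_mul]
  congr 1
  ring

theorem IsSupersolvable.exists_normal_prime_card {G : Type*} [Group G] [Finite G] [Nontrivial G]
    (h : IsSupersolvable G) : ∃ M : Subgroup G, M.Normal ∧ (Nat.card M).Prime := by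
  classical
  obtain ⟨n, s, h0, hn, hN, hc⟩ := h
  have hex : ∃ i, s i ≠ ⊥ := ⟨n, by rw [hn]; exact top_ne_bot⟩
  obtain ⟨i, hi⟩ := Nat.exists_eq_succ_of_ne_zero (n := Nat.find hex)
    (fun h => Nat.find_spec hex (by rw [h, h0]))
  have hi0 : s i = ⊥ := not_not.1 (Nat.find_min hex (hi ▸ Nat.lt_succ_self i))
  have hi1 : s (i + 1) ≠ ⊥ := by
    have := Nat.find_spec hex
    rwa [hi] at this
  have hin : i < n := by
    have : Nat.find hex ≤ n := Nat.find_min' hex (by rw [hn]; exact top_ne_bot)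
    omega
  obtain ⟨x, hx⟩ := hc i hin
  rw [hi0, bot_sup_eq] at hx
  have hxn : (zpowers x).Normal := hx ▸ hN (i + 1)
  have ho : orderOf x ≠ 1 := fun h => hi1 (by
    rw [hx, orderOf_eq_one_iff.1 h, zpowers_one_eq_bot])
  -- The first nontrivial term of the series is cyclic and normal; its subgroup of least prime order
  -- is normal too.
  refine ⟨_, zpowers_pow_normal hxn (orderOf x / (orderOf x).minFac), ?_⟩
  rw [Nat.card_zpowers, orderOf_pow_orderOf_div (orderOf_pos x).ne' (Nat.minFac_dvd _)]
  exact Nat.minFac_prime ho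

theorem IsSupersolvable.hasSeries (hp : p.Prime) {G : Type u} [Group G] [Finite G]
    (h : IsSupersolvable G) : HasSeries p (fun a => ¬ p ∣ a) 1 (⊥ : Subgroup G) := by
  refine HasSeries.one_bot_of_quotient_closed hp (fun G _ => IsSupersolvable G)
    (fun M _ h => h.of_surjective (QuotientGroup.mk'_surjective M)) (fun {G} _ _ _ h => ?_) h
  obtain ⟨M, hM, hpr⟩ := h.exists_normal_prime_card
  refine ⟨M, hM, (one_lt_card_iff_ne_bot M).1 hpr.one_lt, ?_⟩
  by_cases hpM : p ∣ Nat.card M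
  · exact Or.inl ((Nat.prime_dvd_prime_iff_eq hp hpr).1 hpM).symm
  · exact Or.inr hpM

end LengthOne

/-! ### Residuals, the norm and its ascending series. -/

section Norm

variable {p : ℕ}

theorem residual_normal (F : GroupClass.{u}) (T : Type u) [Group T] : (residual F T).Normal := by
  refine ⟨fun x hx g => ?_⟩
  simp only [residual, mem_sInf, Set.mem_ofPred_eq] at hx ⊢
  rintro N ⟨hN, hF⟩
  exact hN.conj_mem x (hx N ⟨hN, hF⟩) g

theorem hasSeries_residual (hp : p.Prime) {F : GroupClass.{u}}
    (hF : ∀ {T : Type u} [Group T] [Finite T], F.Mem T →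
      HasSeries p (fun a => ¬ p ∣ a) 1 (⊥ : Subgroup T)) (T : Type u) [Group T] [Finite T] :
    HasSeries p (fun a => ¬ p ∣ a) 1 (residual F T) := by
  have hβ := isPrimeToClass_not_dvd hp
  have htop : HasSeries p (fun a => ¬ p ∣ a) 1 (⊤ : Subgroup T) :=
    HasSeries.succ hp (by rw [HasSeries, index_top]; exact hβ.one)
  -- By closure under intersections, a minimal such `R` lies in every `N` with `T ⧸ N` in the class,
  -- hence in the residual.
  obtain ⟨R, hR⟩ := (Set.toFinite {R : Subgroup T | R.Normal ∧
    HasSeries p (fun a => ¬ p ∣ a) 1 R}).exists_minimal ⟨⊤, inferInstance, htop⟩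
  obtain ⟨hRn, hRs⟩ := hR.prop
  have := residual_normal F T
  refine hRs.mono hp hβ 1 (le_sInf ?_)
  rintro N ⟨hN, hM⟩
  exact inf_eq_left.1 (hR.eq_of_le ⟨inferInstance, hRs.inf hp hβ 1 (hF hM).of_quotient⟩
    inf_le_left)

theorem normalizesResiduals_normOf (hp : p.Prime) {F : GroupClass.{u}}
    (hF : ∀ {T : Type u} [Group T] [Finite T], F.Mem T →
      HasSeries p (fun a => ¬ p ∣ a) 1 (⊥ : Subgroup T)) (G : Type u) [Group G] [Finite G] :
    NormalizesResiduals p (normOf F G) := fun T =>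
  ⟨residual F T, residual_normal F T, hasSeries_residual hp hF T, iInf_le _ T⟩

theorem le_pull (c : NormalRule.{u}) {G : Type u} [Group G] (N : {N : Subgroup G // N.Normal}) :
    N.1 ≤ (pull c N).1 := by
  have := N.2
  have h : (QuotientGroup.mk' N.1).ker ≤ (pull c N).1 := MonoidHom.ker_le_comap _ _
  rwa [QuotientGroup.ker_mk'] at h

theorem exists_normInfty_eq_ascend (F : GroupClass.{u}) (G : Type u) [Group G] [Finite G] :
    ∃ i, normInfty F G = (ascend (normRule F) G i).1 := by
  have hmono : Monotone fun i : ℕ => (ascend (normRule F) G i).1 :=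
    monotone_nat_of_le_succ fun i => le_pull _ _
  obtain ⟨n, hn⟩ := WellFoundedGT.monotone_chain_condition
    (⟨_, hmono⟩ : ℕ →o Subgroup G)
  refine ⟨n, le_antisymm (sSup_le ?_) (le_sSup ⟨n, rfl⟩)⟩
  rintro _ ⟨i, rfl⟩
  exact (hmono (le_max_right n i)).trans (hn _ (le_max_left n i)).ge

theorem HasSeries.normInfty_iff (hp : p.Prime) {β : ℕ → Prop} (hβ : IsPrimeToClass p β) {n : ℕ}
    (hn : 1 ≤ n)
    (hbase : ∀ (G : Type u) [Group G] [Finite G] (M : Subgroup G), M.Normal → IsPGroup p M →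
      HasSeries p (fun a => ¬ p ∣ a) 1 M → HasSeries p β n (⊥ : Subgroup G))
    {F : GroupClass.{u}} (hF : ∀ {T : Type u} [Group T] [Finite T], F.Mem T →
      HasSeries p (fun a => ¬ p ∣ a) 1 (⊥ : Subgroup T))
    {G : Type u} [Group G] [Finite G] (hG : IsPSolvable p G) :
    HasSeries p β n (⊥ : Subgroup G) ↔
      HasSeries p β n (⊥ : Subgroup (G ⧸ normInfty F G)) := by
  refine ⟨fun h => (h.mono hp hβ n bot_le).quotient hp hβ, fun h => ?_⟩
  replace h := h.of_quotient
  obtain ⟨i, hi⟩ := exists_normInfty_eq_ascend F G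
  rw [hi] at h
  clear hi
  -- Descent along the ascending series: each step lifts the series through the norm of `G ⧸ A`.
  induction i with
  | zero => exact h
  | succ i ih =>
    refine ih ?_
    set A := ascend (normRule F) G i
    have hA := A.2
    have hs := QuotientGroup.mk'_surjective A.1
    have hn' := norm_normal F (G ⧸ A.1)
    refine (HasSeries.bot_of_normalizesResiduals hp hβ hn hbase (hG.of_surjective hs)
      (normalizesResiduals_normOf hp hF (G ⧸ A.1)) ?_).of_quotient
    have h' : HasSeries p β n ((normOf F (G ⧸ A.1)).comap (QuotientGroup.mk' A.1)) := h
    have := h'.map hp hβ hs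
    rwa [map_comap_eq_self_of_surjective hs] at this

end Norm

end NormResidual

namespace NormResidual

universe u

open Subgroup

variable {p : ℕ}

/-! ### The cores and the `p`-Fitting subgroup have their defining properties. -/

section Cores

variable {G : Type u} [Group G] [Finite G]

theorem sSup_mem_of_sup_closed {P : Subgroup G → Prop} (hbot : P ⊥)
    (hsup : ∀ A B, P A → P B → P (A ⊔ B)) : P (sSup {N | P N}) := by
  obtain ⟨M, hM⟩ := (Set.toFinite {N : Subgroup G | P N}).exists_maximal ⟨⊥, hbot⟩
  have : sSup {N | P N} = M := by
    refine le_antisymm (sSup_le fun N hN => ?_) (le_sSup hM.prop)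
    exact sup_eq_left.1 (hM.eq_of_le (hsup _ _ hM.prop hN) le_sup_left).symm
  rw [this]
  exact hM.prop

theorem not_dvd_card_sup (hp : p.Prime) {G : Type*} [Group G] {A B : Subgroup G} [A.Normal] [B.Normal]
    (hA : ¬ p ∣ Nat.card A) (hB : ¬ p ∣ Nat.card B) : ¬ p ∣ Nat.card (A ⊔ B : Subgroup G) := by
  rw [← relIndex_bot_left, ← relIndex_mul_relIndex _ _ _ bot_le le_sup_left, relIndex_bot_left,
    relIndex_sup_left]
  exact (isPrimeToClass_not_dvd hp).mul hA fun h => hB (h.trans (relIndex_dvd_card _ _))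

theorem not_dvd_card_pPrimeCore (hp : p.Prime) (G : Type u) [Group G] [Finite G] :
    ¬ p ∣ Nat.card (pPrimeCore p G).1 :=
  (sSup_mem_of_sup_closed (P := fun N : Subgroup G => N.Normal ∧ ¬ p ∣ Nat.card N)
    ⟨inferInstance, by rw [card_bot]; exact (isPrimeToClass_not_dvd hp).one⟩
    (by rintro A B ⟨hA, hA'⟩ ⟨hB, hB'⟩
        exact ⟨inferInstance, not_dvd_card_sup hp hA' hB'⟩)).2

theorem isPGroup_pCore (p : ℕ) (G : Type u) [Group G] [Finite G] : IsPGroup p (pCore p G).1 :=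
  (sSup_mem_of_sup_closed (P := fun N : Subgroup G => N.Normal ∧ IsPGroup p N)
    ⟨inferInstance, IsPGroup.of_bot⟩
    (by rintro A B ⟨hA, hA'⟩ ⟨hB, hB'⟩
        exact ⟨inferInstance, hA'.to_sup_of_normal_left hB'⟩)).2

/-- A normal `p`-complement of `B` is characteristic in `B` by coprimality, so it is normal in `G`.
-/
theorem isPNilpotent_iff (hp : p.Prime) {B : Subgroup G} [hB : B.Normal] :
    IsPNilpotent p B ↔ ∃ C : Subgroup G, C.Normal ∧ C ≤ B ∧ ¬ p ∣ Nat.card C ∧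
      ∃ m, C.relIndex B = p ^ m := by
  constructor
  · rintro ⟨C, hC, hpC, m, hm⟩
    have hchar : C.Characteristic := characteristic_of_coprime C (by
      rw [hm]
      exact (((Nat.Prime.coprime_iff_not_dvd hp).2 hpC).pow_left m).symm)
    refine ⟨C.map B.subtype, inferInstance, map_subtype_le C, ?_, m, ?_⟩
    · rwa [card_map_of_injective B.subtype_injective]
    · rwa [relIndex, subgroupOf, comap_map_eq_self_of_injective B.subtype_injective]
  · rintro ⟨C, hC, hCB, hpC, m, hm⟩
    exact ⟨C.subgroupOf B, inferInstance,
      by rwa [Nat.card_congr (subgroupOfEquivOfLe hCB).toEquiv], m, hm⟩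

theorem isPNilpotent_pFitting (hp : p.Prime) (G : Type u) [Group G] [Finite G] :
    IsPNilpotent p (pFitting p G).1 := by
  refine (sSup_mem_of_sup_closed (P := fun N : Subgroup G => N.Normal ∧ IsPNilpotent p N)
    ⟨inferInstance, ?_⟩ ?_).2
  · exact (isPNilpotent_iff hp).2 ⟨⊥, inferInstance, le_rfl,
      by rw [card_bot]; exact (isPrimeToClass_not_dvd hp).one, 0,
      by rw [relIndex_self, pow_zero]⟩
  · rintro A B ⟨hA, hA'⟩ ⟨hB, hB'⟩
    refine ⟨inferInstance, ?_⟩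
    obtain ⟨C, hC, hCA, hpC, hm⟩ := (isPNilpotent_iff hp).1 hA'
    obtain ⟨D, hD, hDB, hpD, hm'⟩ := (isPNilpotent_iff hp).1 hB'
    refine (isPNilpotent_iff hp).2 ⟨C ⊔ D, inferInstance, sup_le_sup hCA hDB,
      not_dvd_card_sup hp hpC hpD, ?_⟩
    -- The complement of `A ⊔ B` is `C ⊔ D`; its index is computed through `A ⊔ D`.
    rw [← relIndex_mul_relIndex _ _ _ (sup_le_sup_right hCA D) (sup_le_sup_left hDB A)]
    refine exists_mul_eq_pow (exists_eq_pow_of_dvd hp (relIndex_sup_sup_dvd hCA D) hm) ?_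
    rw [sup_comm A, sup_comm A]
    exact exists_eq_pow_of_dvd hp (relIndex_sup_sup_dvd hDB A) hm'

end Cores

/-! ### One step of the canonical series. -/

section Pull

variable {G : Type u} [Group G] [Finite G] (N : {N : Subgroup G // N.Normal})

theorem relIndex_comap_mk' {G : Type u} [Group G] (N : Subgroup G) [N.Normal]
    (C : Subgroup (G ⧸ N)) : N.relIndex (C.comap (QuotientGroup.mk' N)) = Nat.card C := by
  have := relIndex_ker (C.comap (QuotientGroup.mk' N)) (QuotientGroup.mk' N)
  rwa [QuotientGroup.ker_mk', map_comap_eq_self_of_surjective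
    (QuotientGroup.mk'_surjective N)] at this

theorem card_map_mk'_dvd {G : Type u} [Group G] {N A K : Subgroup G} [N.Normal] [A.Normal]
    (hAN : A ≤ N) (hAK : A ≤ K) : Nat.card (K.map (QuotientGroup.mk' N)) ∣ A.relIndex K := by
  have h : A.map (QuotientGroup.mk' N) = ⊥ := by
    rw [Subgroup.map_eq_bot_iff, QuotientGroup.ker_mk']; exact hAN
  rw [← relIndex_bot_left, ← h]
  exact relIndex_map_dvd _ hAK

theorem not_dvd_relIndex_pull_pPrimeCore (hp : p.Prime) :
    ¬ p ∣ N.1.relIndex (pull (pPrimeCore p) N).1 := by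
  have := N.2
  rw [pull, relIndex_comap_mk']
  exact not_dvd_card_pPrimeCore hp _

theorem exists_relIndex_pull_pCore_eq (hp : p.Prime) :
    ∃ m, N.1.relIndex (pull (pCore p) N).1 = p ^ m := by
  have := N.2
  rw [pull, relIndex_comap_mk']
  have := Fact.mk hp
  exact IsPGroup.iff_card.1 (isPGroup_pCore p _)

theorem exists_between_pull_pFitting (hp : p.Prime) :
    ∃ K : Subgroup G, K.Normal ∧ N.1 ≤ K ∧ K ≤ (pull (pFitting p) N).1 ∧ ¬ p ∣ N.1.relIndex K ∧
      ∃ m, K.relIndex (pull (pFitting p) N).1 = p ^ m := by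
  have := N.2
  have hs := QuotientGroup.mk'_surjective N.1
  have hFn := (pFitting p (G ⧸ N.1)).2
  obtain ⟨C, hC, hCF, hpC, m, hm⟩ := (isPNilpotent_iff hp).1
    (isPNilpotent_pFitting hp (G ⧸ N.1))
  have h : N.1 = (⊥ : Subgroup (G ⧸ N.1)).comap (QuotientGroup.mk' N.1) := by
    rw [MonoidHom.comap_bot, QuotientGroup.ker_mk']
  refine ⟨C.comap (QuotientGroup.mk' N.1), hC.comap _, ?_, comap_mono hCF, ?_, m, ?_⟩
  · conv_lhs => rw [h]
    exact comap_mono bot_le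
  · rwa [relIndex_comap_mk']
  · rw [← hm]
    exact relIndex_comap_comap hs _ _

theorem le_pull_pPrimeCore {G : Type u} [Group G] (N : {N : Subgroup G // N.Normal})
    {A K : Subgroup G} (hA : A.Normal) (hK : K.Normal)
    (hAN : A ≤ N.1) (hAK : A ≤ K) (h : ¬ p ∣ A.relIndex K) : K ≤ (pull (pPrimeCore p) N).1 := by
  have := N.2
  exact map_le_iff_le_comap.1 (le_sSup ⟨hK.map _ (QuotientGroup.mk'_surjective N.1),
    fun h' => h (h'.trans (card_map_mk'_dvd hAN hAK))⟩)

theorem le_pull_pCore (hp : p.Prime) {A K : Subgroup G} (hA : A.Normal) (hK : K.Normal)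
    (hAN : A ≤ N.1) (hAK : A ≤ K) (h : ∃ m, A.relIndex K = p ^ m) :
    K ≤ (pull (pCore p) N).1 := by
  have := N.2
  have := Fact.mk hp
  exact map_le_iff_le_comap.1 (le_sSup ⟨hK.map _ (QuotientGroup.mk'_surjective N.1),
    IsPGroup.iff_card.2 (exists_eq_pow_of_dvd hp (card_map_mk'_dvd hAN hAK) h)⟩)

theorem le_pull_pFitting (hp : p.Prime) {A K B : Subgroup G} (hA : A.Normal) (hK : K.Normal)
    (hB : B.Normal) (hAN : A ≤ N.1) (hAK : A ≤ K) (hKB : K ≤ B) (h : ¬ p ∣ A.relIndex K)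
    (h' : ∃ m, K.relIndex B = p ^ m) : B ≤ (pull (pFitting p) N).1 := by
  have := N.2
  have hs := QuotientGroup.mk'_surjective N.1
  have hB' := hB.map _ hs
  exact map_le_iff_le_comap.1 (le_sSup ⟨hB', (isPNilpotent_iff hp).2
    ⟨K.map _, hK.map _ hs, map_mono hKB, fun hd => h (hd.trans (card_map_mk'_dvd hAN hAK)),
      exists_eq_pow_of_dvd hp (relIndex_map_dvd _ hKB) h'⟩⟩)

end Pull

/-! ### Both lengths expressed through `HasSeries`. -/

section Lengths

variable {G : Type u} [Group G] [Finite G]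

/-- The canonical series grows fastest: if `A ≤ F_p^i(G)`, the next term `B` lies in `F_p^{i+1}(G)`.
-/
theorem HasSeries.ascend_pFitting_eq_top (hp : p.Prime) : ∀ (n i : ℕ) {A : Subgroup G},
    A.Normal → A ≤ (ascend (pFitting p) G i).1 → HasSeries p (· = 1) n A →
    (ascend (pFitting p) G (i + n)).1 = ⊤
  | 0, i, A, _, hAi, h => top_le_iff.1 ((index_eq_one.1 h).symm.le.trans hAi)
  | n + 1, i, A, hA, hAi, ⟨K, B, hK, hB, hAK, hKB, h1, h2, h3⟩ => by
    rw [← add_assoc, add_right_comm]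
    exact h3.ascend_pFitting_eq_top hp n (i + 1) hB
      (le_pull_pFitting _ hp hA hK hB hAi hAK hKB h1 h2)

theorem hasSeries_ascend_pFitting (hp : p.Prime) : ∀ (j i : ℕ),
    (ascend (pFitting p) G (i + j)).1 = ⊤ → HasSeries p (· = 1) j (ascend (pFitting p) G i).1
  | 0, i, h => index_eq_one.2 h
  | j + 1, i, h => by
    obtain ⟨K, hK, h1, h2, h3, h4⟩ :=
      exists_between_pull_pFitting (ascend (pFitting p) G i) hp
    refine ⟨K, _, hK, (pull (pFitting p) (ascend (pFitting p) G i)).2, h1, h2, h3, h4,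
      hasSeries_ascend_pFitting hp j (i + 1) ?_⟩
    rwa [add_right_comm, add_assoc]

/-- `W` plays the role of `P_i(G)`, which `upperPSeries` does not record; the recursion compares the
series with `P_i`, not with `M_i`. -/
theorem HasSeries.upperPSeries_eq_top (hp : p.Prime) : ∀ (n i : ℕ)
    (W : {N : Subgroup G // N.Normal}), upperPSeries p G i = pull (pPrimeCore p) W →
    ∀ {A : Subgroup G}, A.Normal → A ≤ W.1 → HasSeries p (fun a => ¬ p ∣ a) n A →
    (upperPSeries p G (i + n)).1 = ⊤
  | 0, i, W, hW, A, hA, hAW, h => by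
    rw [add_zero, hW]
    exact top_le_iff.1 (le_pull_pPrimeCore W hA inferInstance hAW le_top
      (by rwa [relIndex_top_right]))
  | n + 1, i, W, hW, A, hA, hAW, ⟨K, B, hK, hB, hAK, hKB, h1, h2, h3⟩ => by
    rw [← add_assoc, add_right_comm]
    refine h3.upperPSeries_eq_top hp n (i + 1) (pull (pCore p) (upperPSeries p G i)) rfl hB
      (le_pull_pCore _ hp hK hB ?_ hKB h2)
    rw [hW]
    exact le_pull_pPrimeCore W hA hK hAW hAK h1

theorem hasSeries_of_upperPSeries (hp : p.Prime) : ∀ (j i : ℕ)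
    (W : {N : Subgroup G // N.Normal}), upperPSeries p G i = pull (pPrimeCore p) W →
    (upperPSeries p G (i + j)).1 = ⊤ → HasSeries p (fun a => ¬ p ∣ a) j W.1
  | 0, i, W, hW, h => by
    have := not_dvd_relIndex_pull_pPrimeCore W hp
    rw [← hW, show (upperPSeries p G i).1 = ⊤ from h, relIndex_top_right] at this
    exact this
  | j + 1, i, W, hW, h => by
    refine ⟨(pull (pPrimeCore p) W).1, (pull (pCore p) (pull (pPrimeCore p) W)).1,
      (pull (pPrimeCore p) W).2, (pull (pCore p) (pull (pPrimeCore p) W)).2, le_pull _ _,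
      le_pull _ _, not_dvd_relIndex_pull_pPrimeCore W hp, exists_relIndex_pull_pCore_eq _ hp, ?_⟩
    rw [← hW]
    refine hasSeries_of_upperPSeries hp j (i + 1) (pull (pCore p) (upperPSeries p G i)) rfl ?_
    rwa [add_right_comm, add_assoc]

theorem sInf_natCast_le_iff {Q : ℕ → Prop} {k : ℕ} :
    sInf {m : ℕ∞ | ∃ n : ℕ, Q n ∧ m = (n : ℕ∞)} ≤ (k : ℕ∞) ↔ ∃ n ≤ k, Q n := by
  constructor
  · intro h
    rcases Set.eq_empty_or_nonempty {m : ℕ∞ | ∃ n : ℕ, Q n ∧ m = (n : ℕ∞)} with he | hne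
    · rw [he, sInf_empty, top_le_iff] at h
      exact absurd h (ENat.natCast_ne_top k)
    · obtain ⟨n, hn, he⟩ := csInf_mem hne
      rw [he] at h
      exact ⟨n, Nat.cast_le.1 h, hn⟩
  · rintro ⟨n, hnk, hn⟩
    exact le_trans (sInf_le (Set.mem_ofPred.2 ⟨n, hn, rfl⟩)) (Nat.cast_le.2 hnk)

theorem pFittingLength_le_iff (hp : p.Prime) {k : ℕ} (hk : 1 ≤ k) :
    pFittingLength p G ≤ (k : ℕ∞) ↔ HasSeries p (· = 1) k (⊥ : Subgroup G) := by
  have : pFittingLength p G = sInf {m : ℕ∞ | ∃ n : ℕ,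
      (0 < n ∧ (ascend (pFitting p) G n).1 = ⊤) ∧ m = (n : ℕ∞)} := by
    simp only [pFittingLength, and_assoc]
  rw [this, sInf_natCast_le_iff]
  constructor
  · rintro ⟨n, hnk, -, hn⟩
    have h : HasSeries p (· = 1) n (⊥ : Subgroup G) :=
      hasSeries_ascend_pFitting hp n 0 (by rwa [zero_add])
    exact h.of_le hp hnk
  · intro h
    have := h.ascend_pFitting_eq_top hp k 0 inferInstance bot_le
    rw [zero_add] at this
    exact ⟨k, le_rfl, hk, this⟩

theorem pLength_le_iff (hp : p.Prime) {k : ℕ} :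
    pLength p G ≤ (k : ℕ∞) ↔ HasSeries p (fun a => ¬ p ∣ a) k (⊥ : Subgroup G) := by
  rw [pLength, sInf_natCast_le_iff]
  constructor
  · rintro ⟨n, hnk, hn⟩
    exact (hasSeries_of_upperPSeries hp n 0 ⟨⊥, inferInstance⟩ rfl (by rwa [zero_add])).of_le
      hp hnk
  · intro h
    have := h.upperPSeries_eq_top hp k 0 ⟨⊥, inferInstance⟩ rfl inferInstance le_rfl
    rw [zero_add] at this
    exact ⟨k, le_rfl, this⟩

end Lengths

/-! ### The base case: a `p`-group below a quotient of `p`-length at most one. -/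

section Base

theorem HasSeries.succ_bot_of_isPGroup (hp : p.Prime) {β : ℕ → Prop} {n : ℕ}
    {G : Type*} [Group G] [Finite G] {M : Subgroup G} (hM : M.Normal)
    (hpM : IsPGroup p M) (h : HasSeries p β n M) : HasSeries p β (n + 1) (⊥ : Subgroup G) := by
  have := Fact.mk hp
  refine ⟨⊥, M, inferInstance, hM, le_rfl, bot_le, ?_, ?_, h⟩
  · rw [relIndex_self]; exact (isPrimeToClass_not_dvd hp).one
  · rw [relIndex_bot_left]; exact IsPGroup.iff_card.1 hpM

theorem HasSeries.one_of_not_dvd_index {G : Type*} [Group G] {A : Subgroup G} (h : ¬ p ∣ A.index) :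
    HasSeries p (· = 1) 1 A :=
  ⟨⊤, ⊤, inferInstance, inferInstance, le_top, le_rfl, by rwa [relIndex_top_right],
    ⟨0, by rw [relIndex_self, pow_zero]⟩, index_top⟩

theorem HasSeries.two_of_one {G : Type*} [Group G] {A : Subgroup G} (h : HasSeries p (fun a => ¬ p ∣ a) 1 A) :
    HasSeries p (· = 1) 2 A := by
  obtain ⟨K, B, hK, hB, hAK, hKB, h1, h2, h3⟩ := h
  exact ⟨K, B, hK, hB, hAK, hKB, h1, h2, HasSeries.one_of_not_dvd_index h3⟩

end Base

/-! ### Solvable groups are `p`-solvable. -/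

section Solvable

theorem isPSolvable_of_isSolvable (hp : p.Prime) {G : Type u} [Group G] [Finite G]
    [Group.IsSolvable G] : IsPSolvable p G := by
  have := Fact.mk hp
  intro H K hHK
  have := hHK.normal_bot
  have := hHK.normal_top
  have hs := QuotientGroup.mk'_surjective H
  have hHc : (⊥ : Subgroup (G ⧸ H)).comap (QuotientGroup.mk' H) = H := by
    rw [MonoidHom.comap_bot, QuotientGroup.ker_mk']
  have hmin : ∀ L : Subgroup (G ⧸ H), L.Normal → L ≤ K.map (QuotientGroup.mk' H) →
      L = ⊥ ∨ L = K.map (QuotientGroup.mk' H) := by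
    intro L hL hLK
    have hHL : H ≤ L.comap (QuotientGroup.mk' H) := by
      conv_lhs => rw [← hHc]
      exact comap_mono bot_le
    have hLK' : L.comap (QuotientGroup.mk' H) ≤ K := by
      refine (comap_mono hLK).trans ?_
      rw [comap_map_eq_self (by rw [QuotientGroup.ker_mk']; exact hHK.lt.le)]
    have hLm := map_comap_eq_self_of_surjective hs L
    refine (hHK.eq_or_eq _ (hL.comap _) hHL hLK').imp (fun h => ?_) (fun h => ?_)
    · rw [← hLm, h, QuotientGroup.map_mk'_self]
    · rw [← hLm, h]
  set V := K.map (QuotientGroup.mk' H) with hV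
  have hVn : V.Normal := hHK.normal_top.map _ hs
  have hcard : H.relIndex K = Nat.card V := by
    rw [← relIndex_ker, QuotientGroup.ker_mk']
  rw [hcard]
  have hV0 : V ≠ ⊥ := by
    rw [← one_lt_card_iff_ne_bot, ← hcard]
    refine (Nat.one_lt_iff_ne_zero_and_ne_one).2 ⟨?_, fun h => ?_⟩
    · rw [hcard]; exact Nat.card_pos.ne'
    exact hHK.lt.not_ge (relIndex_eq_one.1 h)
  have hVnt : Nontrivial V := (nontrivial_iff_ne_bot _).2 hV0
  -- The commutator subgroup is characteristic and, by solvability, proper, so minimality kills it.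
  -- In the abelian `V` the Sylow `p`-subgroup is characteristic, hence trivial or everything.
  have hcommV : commutator V = ⊥ := by
    rcases hmin ((commutator V).map V.subtype) inferInstance (map_subtype_le _) with h | h
    · rwa [map_eq_bot_iff_of_injective _ V.subtype_injective] at h
    · refine absurd ?_ (Group.IsSolvable.commutator_lt_top_of_nontrivial V).ne
      refine map_injective V.subtype_injective ?_
      rw [h, ← MonoidHom.range_eq_map, V.range_subtype]
  have hcomm : IsMulCommutative V := by
    rw [← center_eq_top_iff]
    exact (commutator_eq_bot_iff_center_eq_top V).1 hcommV
  obtain ⟨S⟩ : Nonempty (Sylow p V) := inferInstance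
  have hSn : (S : Subgroup V).Normal := ⟨fun x hx g => by
    rwa [mul_comm' g x, mul_inv_cancel_right]⟩
  have := S.characteristic_of_normal hSn
  rcases hmin ((S : Subgroup V).map V.subtype) inferInstance (map_subtype_le _) with h | h
  · right
    rw [map_eq_bot_iff_of_injective _ V.subtype_injective] at h
    have := S.not_dvd_index
    rwa [h, index_bot] at this
  · left
    have := IsPGroup.iff_card.1 (S.isPGroup'.map V.subtype)
    rwa [h] at this

end Solvable

end NormResidual

theorem theorem5p4 {G : Type*} [Group G] [Finite G] (p : ℕ) (hp : p.Prime) :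
    (NormResidual.IsPSolvable p G → ∀ k : ℕ, 3 ≤ k →
      (NormResidual.pFittingLength p G ≤ (k : ℕ∞) ↔
        NormResidual.pFittingLength p
          (G ⧸ NormResidual.normInfty (NormResidual.pSupersolvableClass p) G) ≤ (k : ℕ∞))) ∧
    (Group.IsSolvable G → ∀ k : ℕ, 2 ≤ k →
      (NormResidual.pLength p G ≤ (k : ℕ∞) ↔
        NormResidual.pLength p
          (G ⧸ NormResidual.normInfty NormResidual.supersolvableClass G) ≤ (k : ℕ∞))) := by
  refine ⟨fun hG k hk => ?_, fun hG k hk => ?_⟩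
  · have hk1 : 1 ≤ k := le_trans (by norm_num) hk
    rw [NormResidual.pFittingLength_le_iff hp hk1, NormResidual.pFittingLength_le_iff hp hk1]
    exact NormResidual.HasSeries.normInfty_iff hp (NormResidual.isPrimeToClass_eq_one hp) hk1
      -- Three pairs: `M`, then the pair of `G ⧸ M`, then its last `p'`-factor, which must be
      -- counted when the end is required to be trivial.
      (fun G _ _ M hM hpM h => (h.two_of_one.succ_bot_of_isPGroup hp hM hpM).of_le hp hk)
      (fun h => NormResidual.IsPSupersolvable.hasSeries hp h) hG
  · rw [NormResidual.pLength_le_iff hp, NormResidual.pLength_le_iff hp]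
    exact NormResidual.HasSeries.normInfty_iff hp (NormResidual.isPrimeToClass_not_dvd hp) (le_trans (by norm_num) hk)
      -- Here a final `p'`-factor is free, so two pairs suffice.
      (fun G _ _ M hM hpM h => (h.succ_bot_of_isPGroup hp hM hpM).of_le hp hk)
      (fun h => NormResidual.IsSupersolvable.hasSeries hp h) (NormResidual.isPSolvable_of_isSolvable hp)
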